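/- Let $G=\langle x_1,x_2,x_3,x_4,t \mid t^4=1,\ t^{-1}x_it=x_{i+1}\ (1\le i\le 4)\rangle$, where indices are taken modulo $4$ (so $x_5=x_1$), and let $L_1=\langle x_1,x_2,x_3\rangle\le G$. For a subgroup $H$ of a group $G$, elements $g_1,\dots,g_n\in G$ are called $H$-essentially distinct if $Hg_i\ne Hg_j$ for $i\neq j$, and strongly $H$-essentially distinct if $Hg_iH\neq Hg_jH$ for $i\ne j$; the conjugates $g_i^{-1}Hg_i$ are then called (strongly) essentially distinct conjugates of $H$. For infinite $H$: * $\mathrm{Height}(H,G)$ is the maximal $n$ such that there are $n$ essentially distinct conjugates of $H$ in $G$ whose common intersection is infinite; * $\mathrm{Width}(H,G)$ is the maximal $n$ such that there are $n$ essentially distinct conjugates of $H$ in $G$ any two of which have infinite intersection; * $\mathrm{WeakWidth}(H,G)$ is the maximal $n$ such that there are elements $g_0=1,g_1,\dots,g_{n-1}$ of $G$ that are strongly $H$-essentially distinct and satisfy $|H\cap g_i^{-1}Hg_i|=\infty$ for $1\le i\le n-1$. Each of these is $\infty$ if no maximal $n$ exists, and $0$ if $H$ is finite. Then $$\mathrm{WeakWidth}(L_1,G)=\mathrm{Width}(L_1,G)=4,\qquad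 \mathrm{Height}(L_1,G)=3.$$ In particular, $\mathrm{Width}(L_1,G)\ne\mathrm{Height}(L_1,G)$. -/

import Mathlib

namespace SubgroupWidth

section Invariants

variable {G : Type*} [Group G]

/-- The conjugate `g⁻¹ H g`. -/
def conjBy (H : Subgroup G) (g : G) : Subgroup G :=
  H.map (MulAut.conj g⁻¹).toMonoidHom

/-- The right coset `H g`. -/
def rightCoset (H : Subgroup G) (g : G) : Set G :=
  {y | ∃ h ∈ H, y = h * g}

/-- The double coset `H g H`. -/
def dblCoset (H : Subgroup G) (g : G) : Set G :=
  {y | ∃ h₁ ∈ H, ∃ h₂ ∈ H, y = h₁ * g * h₂}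

/-- A family of elements is `H`-essentially distinct if `H gᵢ ≠ H gⱼ` for `i ≠ j`. -/
def EssentiallyDistinct (H : Subgroup G) {n : ℕ} (g : Fin n → G) : Prop :=
  ∀ i j, i ≠ j → rightCoset H (g i) ≠ rightCoset H (g j)

/-- A family of elements is strongly `H`-essentially distinct if `H gᵢ H ≠ H gⱼ H` for `i ≠ j`. -/
def StronglyEssentiallyDistinct (H : Subgroup G) {n : ℕ} (g : Fin n → G) : Prop :=
  ∀ i j, i ≠ j → dblCoset H (g i) ≠ dblCoset H (g j)

/-- There are `n` essentially distinct conjugates of `H` whose common intersection is infinite. -/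
def HasHeightFamily (H : Subgroup G) (n : ℕ) : Prop :=
  ∃ g : Fin n → G, EssentiallyDistinct H g ∧ Infinite ↥(⨅ i, conjBy H (g i))

/-- There are `n` essentially distinct conjugates of `H` any two of which have infinite
intersection. -/
def HasWidthFamily (H : Subgroup G) (n : ℕ) : Prop :=
  ∃ g : Fin n → G, EssentiallyDistinct H g ∧
    ∀ i j, i ≠ j → Infinite ↥(conjBy H (g i) ⊓ conjBy H (g j))

/-- There are `n` strongly essentially distinct conjugates of `H`, one of them being `H` itself
(the conjugate by `1`), each of the others having infinite intersection with `H`. -/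
def HasWeakWidthFamily (H : Subgroup G) (n : ℕ) : Prop :=
  ∃ g : Fin n → G, StronglyEssentiallyDistinct H g ∧
    ∃ i₀, g i₀ = 1 ∧ ∀ i, i ≠ i₀ → Infinite ↥(H ⊓ conjBy H (g i))

open Classical in
/-- The height of `H` in `G`: `0` if `H` is finite, and otherwise the largest size of a family of
essentially distinct conjugates with infinite common intersection (`⊤` if there is no largest). -/
noncomputable def height (H : Subgroup G) : ℕ∞ :=
  if Finite H then 0 else ⨆ (n : ℕ) (_ : HasHeightFamily H n), (n : ℕ∞)

open Classical in
/-- The width of `H` in `G`: `0` if `H` is finite, and otherwise the largest size of a family of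
essentially distinct conjugates with infinite pairwise intersections (`⊤` if there is no
largest). -/
noncomputable def width (H : Subgroup G) : ℕ∞ :=
  if Finite H then 0 else ⨆ (n : ℕ) (_ : HasWidthFamily H n), (n : ℕ∞)

open Classical in
/-- The weak width of `H` in `G`: `0` if `H` is finite, and otherwise the largest size of a family
of strongly essentially distinct conjugates, containing `H`, each of which has infinite
intersection with `H` (`⊤` if there is no largest). -/
noncomputable def weakWidth (H : Subgroup G) : ℕ∞ :=
  if Finite H then 0 else ⨆ (n : ℕ) (_ : HasWeakWidthFamily H n), (n : ℕ∞)

end Invariants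

/-- The generators `x₁, x₂, x₃, x₄ = x₀` (indices modulo 4) and `t`. -/
inductive Gen : Type
  | x (i : ZMod 4)
  | t

/-- The relators of `t⁴ = 1` and `t⁻¹ xᵢ t = xᵢ₊₁` (indices modulo 4). -/
def relators : Set (FreeGroup Gen) :=
  {FreeGroup.of Gen.t ^ 4} ∪
    Set.range fun i : ZMod 4 =>
      (FreeGroup.of Gen.t)⁻¹ * FreeGroup.of (Gen.x i) * FreeGroup.of Gen.t *
        (FreeGroup.of (Gen.x (i + 1)))⁻¹

/-- The group `G = ⟨x₁, x₂, x₃, x₄, t ∣ t⁴ = 1, t⁻¹ xᵢ t = xᵢ₊₁⟩`. -/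
abbrev ExampleGroup : Type :=
  PresentedGroup relators

/-- The element `xᵢ` of the group. -/
def x (i : ZMod 4) : ExampleGroup :=
  PresentedGroup.of (Gen.x i)

/-- The subgroup `L₁ = ⟨x₁, x₂, x₃⟩`. -/
def L₁ : Subgroup ExampleGroup :=
  Subgroup.closure {x 1, x 2, x 3}

end SubgroupWidth

/-! `G` is the semidirect product of the free group on the `xᵢ` with `ℤ/4`, and `L₁` is the free
factor omitting the letter `0`. Writing an element as `t ^ n * f` with `f` free, its conjugate of
`L₁` is the `f`-conjugate of the factor omitting the letter `n`; the class of `n` is its `color`.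

The key fact is `exists_mul_eq_of_conj_mem_freeFactor`. For equal colors it shows that nontrivially
intersecting conjugates have the same coset (`rightCoset_eq_of_color_eq`); if one conjugate is `L₁`
itself, it shows that the double coset depends only on the color (`dblCoset_eq_of_infinite`). So
both widths are at most 4, and the powers of `t` attain this, since two omitted letters leave a
common one.

For the height, a nontrivial element common to conjugates of all four colors would be conjugate into
the factor on no letters (`exists_conj_mem_freeFactor_iInter`), which is trivial; three colors still
leave one letter. -/

namespace SubgroupWidth

/-! ### Conjugates of free factors in a free group -/

section Parabolic

variable {α : Type*}

/-- The free factor of a free group generated by the letters in `S`. -/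
def freeFactor (S : Set α) : Subgroup (FreeGroup α) :=
  Subgroup.closure (FreeGroup.of '' S)

theorem of_mem_freeFactor {S : Set α} {a : α} (ha : a ∈ S) : FreeGroup.of a ∈ freeFactor S :=
  Subgroup.subset_closure ⟨a, ha, rfl⟩

theorem mk_singleton_mem_freeFactor {S : Set α} {z : α × Bool} (hz : z.1 ∈ S) :
    FreeGroup.mk [z] ∈ freeFactor S := by
  obtain ⟨a, b⟩ := z
  cases b
  · have := (freeFactor S).inv_mem (of_mem_freeFactor hz)
    simpa [FreeGroup.of, FreeGroup.inv_mk, FreeGroup.invRev] using this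
  · exact of_mem_freeFactor hz

theorem mk_mem_freeFactor {S : Set α} {L : List (α × Bool)} (hL : ∀ z ∈ L, z.1 ∈ S) :
    FreeGroup.mk L ∈ freeFactor S := by
  induction L with
  | nil => exact (freeFactor S).one_mem
  | cons z L ih =>
    rw [List.forall_mem_cons] at hL
    have := (freeFactor S).mul_mem (mk_singleton_mem_freeFactor hL.1) (ih hL.2)
    rwa [FreeGroup.mul_mk] at this

theorem map_freeFactor {β : Type*} (e : α → β) (S : Set α) :
    (freeFactor S).map (FreeGroup.map e) = freeFactor (e '' S) := by
  simp only [freeFactor, MonoidHom.map_closure, Set.image_image, FreeGroup.map.of]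

variable [DecidableEq α]

theorem mem_freeFactor_iff {S : Set α} {w : FreeGroup α} :
    w ∈ freeFactor S ↔ ∀ z ∈ w.toWord, z.1 ∈ S := by
  refine ⟨fun hw => ?_, fun h => FreeGroup.mk_toWord (x := w) ▸ mk_mem_freeFactor h⟩
  induction hw using Subgroup.closure_induction with
  | mem w hw =>
    obtain ⟨a, ha, rfl⟩ := hw
    simpa using ha
  | one => simp
  | mul u v _ _ hu hv =>
    intro z hz
    rcases List.mem_append.1 ((FreeGroup.toWord_mul_sublist u v).subset hz) with h | h
    exacts [hu z h, hv z h]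
  | inv u _ hu =>
    intro z hz
    rw [FreeGroup.toWord_inv] at hz
    simp only [FreeGroup.invRev, List.mem_reverse, List.mem_map] at hz
    obtain ⟨y, hy, rfl⟩ := hz
    exact hu y hy

theorem freeFactor_inf (S T : Set α) : freeFactor S ⊓ freeFactor T = freeFactor (S ∩ T) := by
  ext w
  simp only [Subgroup.mem_inf, mem_freeFactor_iff, Set.mem_inter_iff]
  exact ⟨fun h z hz => ⟨h.1 z hz, h.2 z hz⟩, fun h => ⟨fun z hz => (h z hz).1, fun z hz => (h z hz).2⟩⟩

/-- The letters of `b` lie in `T` and `z` does not, so nothing cancels at either junction. -/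
theorem toWord_conj_of_getLast {T : Set α} {b : FreeGroup α} (hb : b ∈ freeFactor T) (hb1 : b ≠ 1)
    {L : List (α × Bool)} {z : α × Bool} (hL : FreeGroup.IsReduced (L ++ [z])) (hz : z.1 ∉ T) :
    (FreeGroup.mk (L ++ [z]) * b * (FreeGroup.mk (L ++ [z]))⁻¹).toWord =
      L ++ [z] ++ b.toWord ++ FreeGroup.invRev (L ++ [z]) := by
  have hinv : FreeGroup.IsReduced (FreeGroup.invRev (L ++ [z])) := by
    rw [FreeGroup.isReduced_iff_reduce_eq, FreeGroup.reduce_invRev, hL.reduce_eq]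
  have hbT := mem_freeFactor_iff.1 hb
  conv_lhs => rw [← FreeGroup.mk_toWord (x := b)]
  rw [FreeGroup.inv_mk, FreeGroup.mul_mk, FreeGroup.mul_mk, FreeGroup.toWord_mk]
  refine (FreeGroup.IsReduced.append_overlap ?_ ?_ ?_).reduce_eq
  · refine List.isChain_append.2 ⟨hL, FreeGroup.isReduced_toWord, ?_⟩
    intro x hx y hy hxy
    simp only [List.getLast?_append, List.getLast?_singleton, Option.some_or,
      Option.mem_def, Option.some.injEq] at hx
    subst hx
    exact absurd (hxy ▸ hbT y (List.mem_of_mem_head? hy)) hz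
  · refine List.isChain_append.2 ⟨FreeGroup.isReduced_toWord, hinv, ?_⟩
    intro x hx y hy hxy
    simp only [FreeGroup.invRev, List.map_append, List.map_cons, List.map_nil,
      List.reverse_append, List.reverse_cons, List.reverse_nil, List.nil_append,
      List.singleton_append, List.head?_cons, Option.mem_def, Option.some.injEq] at hy
    subst hy
    exact absurd (hxy ▸ hbT x (List.mem_of_mem_getLast? hx)) hz
  · rwa [ne_eq, FreeGroup.toWord_eq_nil_iff]

/-- If two conjugates of free factors intersect nontrivially, then the conjugating element is a
product of elements of the factors. -/
theorem exists_mul_eq_of_conj_mem_freeFactor {S T : Set α} {u b : FreeGroup α}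
    (hb : b ∈ freeFactor T) (hb1 : b ≠ 1) (h : u * b * u⁻¹ ∈ freeFactor S) :
    ∃ p ∈ freeFactor S, ∃ q ∈ freeFactor T, u = p * q := by
  suffices H : ∀ (L : List (α × Bool)), FreeGroup.IsReduced L → ∀ b ∈ freeFactor T, b ≠ 1 →
      FreeGroup.mk L * b * (FreeGroup.mk L)⁻¹ ∈ freeFactor S →
      ∃ p ∈ freeFactor S, ∃ q ∈ freeFactor T, FreeGroup.mk L = p * q by
    simpa only [FreeGroup.mk_toWord] using H u.toWord FreeGroup.isReduced_toWord b hb hb1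
      (by rwa [FreeGroup.mk_toWord])
  intro L
  induction L using List.reverseRecOn with
  | nil => exact fun _ _ _ _ _ => ⟨1, one_mem _, 1, one_mem _, by simp [FreeGroup.one_eq_mk]⟩
  | append_singleton L z ih =>
    intro hL b hb hb1 h
    -- A last letter in `T` is absorbed into `b`, which is why the induction quantifies over `b`.
    by_cases hz : z.1 ∈ T
    · have hzT := mk_singleton_mem_freeFactor hz
      obtain ⟨p, hp, q, hq, hpq⟩ := ih (hL.infix ⟨[], [z], by simp⟩)
        (FreeGroup.mk [z] * b * (FreeGroup.mk [z])⁻¹)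
        (mul_mem (mul_mem hzT hb) (inv_mem hzT)) (by rwa [ne_eq, conj_eq_one_iff])
        (by rw [← FreeGroup.mul_mk, mul_inv_rev] at h; simpa only [mul_assoc] using h)
      exact ⟨p, hp, q * FreeGroup.mk [z], mul_mem hq hzT, by
        rw [← FreeGroup.mul_mk, hpq, mul_assoc]⟩
    -- Without cancellation the whole conjugator is a prefix of a reduced word in the letters of
    -- `S`, so `q = 1` works.
    · refine ⟨_, mk_mem_freeFactor fun y hy => ?_, 1, one_mem _, (mul_one _).symm⟩
      rw [mem_freeFactor_iff, toWord_conj_of_getLast hb hb1 hL hz] at h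
      exact h y (by simp only [List.mem_append] at hy ⊢; tauto)

/-- Nontrivially intersecting conjugates of two free factors intersect inside a conjugate of the
intersection of the factors. -/
theorem exists_conj_mem_freeFactor_inter {S T : Set α} {f g w : FreeGroup α} (hw : w ≠ 1)
    (hf : f * w * f⁻¹ ∈ freeFactor S) (hg : g * w * g⁻¹ ∈ freeFactor T) :
    ∃ h, h * w * h⁻¹ ∈ freeFactor (S ∩ T) := by
  obtain ⟨p, hp, q, hq, hpq⟩ := exists_mul_eq_of_conj_mem_freeFactor (u := f * g⁻¹) hg
    (by simpa using hw) (by simpa [mul_assoc] using hf)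
  -- Since `f * g⁻¹ = p * q`, also `q * g = p⁻¹ * f`, so this conjugate lies in both factors.
  refine ⟨q * g, ?_⟩
  rw [← freeFactor_inf]
  refine Subgroup.mem_inf.2 ⟨?_, ?_⟩
  · have : q * g = p⁻¹ * f := by rw [eq_inv_mul_iff_mul_eq, ← mul_assoc, ← hpq]; group
    rw [this]
    convert mul_mem (mul_mem (inv_mem hp) hf) hp using 1
    group
  · convert mul_mem (mul_mem hq hg) (inv_mem hq) using 1
    group

theorem exists_conj_mem_freeFactor_iInter {ι : Type*} (s : Finset ι) (S : ι → Set α)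
    {w : FreeGroup α} (hw : w ≠ 1) (h : ∀ i ∈ s, ∃ f, f * w * f⁻¹ ∈ freeFactor (S i)) :
    ∃ f, f * w * f⁻¹ ∈ freeFactor (⋂ i ∈ s, S i) := by
  classical
  induction s using Finset.induction_on with
  | empty => exact ⟨1, mem_freeFactor_iff.2 (by simp)⟩
  | insert a s _ ih =>
    obtain ⟨f, hf⟩ := h a (Finset.mem_insert_self a s)
    obtain ⟨g, hg⟩ := ih fun i hi => h i (Finset.mem_insert_of_mem hi)
    rw [Finset.set_biInter_insert]
    exact exists_conj_mem_freeFactor_inter hw hf hg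

end Parabolic

/-! ### Conjugates and cosets in a general group -/

section Invariants

variable {G : Type*} [Group G]

theorem mem_conjBy {H : Subgroup G} {g y : G} : y ∈ conjBy H g ↔ g * y * g⁻¹ ∈ H := by
  simp only [conjBy, Subgroup.mem_map, MulEquiv.coe_toMonoidHom, MulAut.conj_apply, inv_inv]
  constructor
  · rintro ⟨h, hh, rfl⟩
    convert hh using 1
    group
  · intro h
    exact ⟨_, h, by group⟩

theorem conjBy_one (H : Subgroup G) : conjBy H 1 = H := by
  ext; simp [mem_conjBy]

theorem rightCoset_eq_of_mul_inv_mem {H : Subgroup G} {a b : G} (h : a * b⁻¹ ∈ H) :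
    rightCoset H a = rightCoset H b := by
  ext y
  constructor
  · rintro ⟨c, hc, rfl⟩
    exact ⟨c * (a * b⁻¹), mul_mem hc h, by group⟩
  · rintro ⟨c, hc, rfl⟩
    exact ⟨c * (a * b⁻¹)⁻¹, mul_mem hc (inv_mem h), by group⟩

theorem dblCoset_mul_mul {H : Subgroup G} {p q : G} (hp : p ∈ H) (hq : q ∈ H) (a : G) :
    dblCoset H (p * a * q) = dblCoset H a := by
  ext y
  constructor
  · rintro ⟨c, hc, d, hd, rfl⟩
    exact ⟨c * p, mul_mem hc hp, q * d, mul_mem hq hd, by group⟩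
  · rintro ⟨c, hc, d, hd, rfl⟩
    exact ⟨c * p⁻¹, mul_mem hc (inv_mem hp), q⁻¹ * d, mul_mem (inv_mem hq) hd, by group⟩

theorem exists_mem_ne_one_of_infinite {H : Subgroup G} (h : Infinite H) : ∃ y ∈ H, y ≠ 1 :=
  H.ne_bot_iff_exists_ne_one.1 (by rintro rfl; exact not_finite (⊥ : Subgroup G)) |>.imp'
    Subtype.val fun a ha => ⟨a.2, by simpa using ha⟩

end Invariants

/-! ### The group as a semidirect product -/

/-- The action of `ℤ/4` on the free group by shifting the generators. -/
def shiftAut : Multiplicative (ZMod 4) →* MulAut (FreeGroup (ZMod 4)) where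
  -- The shift is downward because the semidirect product acts by `t * x * t⁻¹`, while the relators
  -- use `t⁻¹ * x * t`.
  toFun k := FreeGroup.freeGroupCongr (Equiv.subRight k.toAdd)
  map_one' := by
    ext w
    change FreeGroup.map _ w = w
    rw [show (⇑(Equiv.subRight (Multiplicative.toAdd (1 : Multiplicative (ZMod 4))))) = id from
      funext fun i => by simp, FreeGroup.map.id]
  map_mul' k l := by
    ext w
    change FreeGroup.map _ w = FreeGroup.map _ (FreeGroup.map _ w)
    rw [FreeGroup.map.comp]
    congr 2
    ext i
    simp [sub_sub, add_comm]

theorem shiftAut_of (k : Multiplicative (ZMod 4)) (i : ZMod 4) :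
    shiftAut k (FreeGroup.of i) = FreeGroup.of (i - k.toAdd) :=
  FreeGroup.map.of

/-- The element `t` of the group. -/
def tElem : ExampleGroup := PresentedGroup.of Gen.t

theorem tElem_pow_four : tElem ^ 4 = 1 := by
  have := PresentedGroup.one_of_mem (rels := relators) (x := FreeGroup.of Gen.t ^ 4) (Or.inl rfl)
  rwa [map_pow] at this

theorem inv_tElem_mul_x_mul_tElem (i : ZMod 4) : tElem⁻¹ * x i * tElem = x (i + 1) := by
  have := PresentedGroup.one_of_mem (rels := relators) (Or.inr ⟨i, rfl⟩)
  simp only [map_mul, map_inv] at this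
  exact mul_inv_eq_one.1 this

/-- The inclusion of the free group on the `xᵢ`. -/
def freeHom : FreeGroup (ZMod 4) →* ExampleGroup := FreeGroup.lift x

theorem freeHom_of (i : ZMod 4) : freeHom (FreeGroup.of i) = x i := FreeGroup.lift_apply_of

theorem inv_tElem_mul_freeHom_mul_tElem (f : FreeGroup (ZMod 4)) :
    tElem⁻¹ * freeHom f * tElem = freeHom (FreeGroup.map (· + 1) f) := by
  have : (MulAut.conj tElem⁻¹).toMonoidHom.comp freeHom =
      freeHom.comp (FreeGroup.map (· + 1)) := by
    ext i
    simpa [freeHom_of] using inv_tElem_mul_x_mul_tElem i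
  simpa using DFunLike.congr_fun this f

theorem inv_tElem_pow_mul_freeHom_mul_tElem_pow (n : ℕ) (f : FreeGroup (ZMod 4)) :
    (tElem ^ n)⁻¹ * freeHom f * tElem ^ n = freeHom (FreeGroup.map (· + (n : ZMod 4)) f) := by
  induction n with
  | zero => simp [FreeGroup.map.id']
  | succ n ih =>
    calc _ = tElem⁻¹ * ((tElem ^ n)⁻¹ * freeHom f * tElem ^ n) * tElem := by
          rw [pow_succ]; group
      _ = _ := by
          rw [ih, inv_tElem_mul_freeHom_mul_tElem, FreeGroup.map.comp]
          congr 3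
          ext i
          simp [add_assoc]

/-- Powers of `t` move left past free elements at the cost of a shift; `t⁻¹ = t ^ 3` keeps exponents
natural. -/
theorem exists_eq_tElem_pow_mul_freeHom (g : ExampleGroup) :
    ∃ (n : ℕ) (f : FreeGroup (ZMod 4)), g = tElem ^ n * freeHom f := by
  have ht (f : FreeGroup (ZMod 4)) :
      freeHom f * tElem = tElem * freeHom (FreeGroup.map (· + 1) f) := by
    rw [← inv_tElem_mul_freeHom_mul_tElem]; group
  have hinv : tElem⁻¹ = tElem ^ 3 := by
    rw [inv_eq_iff_mul_eq_one, ← pow_succ', tElem_pow_four]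
  have hg : g ∈ Subgroup.closure (Set.range (PresentedGroup.of (rels := relators))) := by
    rw [PresentedGroup.closure_range_of]; trivial
  have htn (n : ℕ) (f : FreeGroup (ZMod 4)) : freeHom f * tElem ^ n =
      tElem ^ n * freeHom (FreeGroup.map (· + (n : ZMod 4)) f) := by
    rw [← inv_tElem_pow_mul_freeHom_mul_tElem_pow]; group
  induction hg using Subgroup.closure_induction_right with
  | one => exact ⟨0, 1, by simp⟩
  | mul_right g _ y hy ih =>
    obtain ⟨n, f, rfl⟩ := ih
    obtain ⟨i | _, rfl⟩ := hy
    · exact ⟨n, f * FreeGroup.of i, by rw [map_mul, freeHom_of, mul_assoc]; rfl⟩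
    · refine ⟨n + 1, FreeGroup.map (· + 1) f, ?_⟩
      rw [pow_succ, mul_assoc _ tElem, ← ht, mul_assoc]
      rfl
  | mul_inv_cancel g _ y hy ih =>
    obtain ⟨n, f, rfl⟩ := ih
    obtain ⟨i | _, rfl⟩ := hy
    · exact ⟨n, f * (FreeGroup.of i)⁻¹, by rw [map_mul, map_inv, freeHom_of, mul_assoc]; rfl⟩
    · refine ⟨n + 3, FreeGroup.map (· + ((3 : ℕ) : ZMod 4)) f, ?_⟩
      rw [pow_add, mul_assoc _ (tElem ^ 3), ← htn, ← hinv, mul_assoc]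
      rfl

/-- The images of the generators in the semidirect product. -/
def genToSemidirect : Gen → FreeGroup (ZMod 4) ⋊[shiftAut] Multiplicative (ZMod 4)
  | Gen.x i => SemidirectProduct.inl (FreeGroup.of i)
  | Gen.t => SemidirectProduct.inr (Multiplicative.ofAdd 1)

theorem lift_genToSemidirect_relators :
    ∀ r ∈ relators, FreeGroup.lift genToSemidirect r = 1 := by
  rintro r (rfl | ⟨i, rfl⟩)
  · rw [map_pow, FreeGroup.lift_apply_of, genToSemidirect, ← map_pow]
    exact map_one _
  · simp only [map_mul, map_inv, FreeGroup.lift_apply_of, genToSemidirect]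
    rw [mul_inv_eq_one, ← map_inv, ← SemidirectProduct.inl_inj (φ := shiftAut) |>.2 (?_ :
      shiftAut (Multiplicative.ofAdd 1)⁻¹ (FreeGroup.of i) = FreeGroup.of (i + 1)),
      SemidirectProduct.inl_aut, inv_inv]
    rw [shiftAut_of, toAdd_inv, toAdd_ofAdd, sub_neg_eq_add]

/-- The map onto the semidirect product `F₄ ⋊ ℤ/4`. -/
def toSemidirect : ExampleGroup →* FreeGroup (ZMod 4) ⋊[shiftAut] Multiplicative (ZMod 4) :=
  PresentedGroup.toGroup lift_genToSemidirect_relators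

theorem toSemidirect_freeHom (f : FreeGroup (ZMod 4)) :
    toSemidirect (freeHom f) = SemidirectProduct.inl f := by
  have : toSemidirect.comp freeHom = SemidirectProduct.inl := by
    ext1 i
    rw [MonoidHom.comp_apply, freeHom_of]
    exact PresentedGroup.toGroup.of _
  exact DFunLike.congr_fun this f

theorem freeHom_injective : Function.Injective freeHom := fun f g h =>
  SemidirectProduct.inl_injective (φ := shiftAut) <| by
    rw [← toSemidirect_freeHom, ← toSemidirect_freeHom, h]

/-- The projection to `ℤ/4`, sending `t` to the generator and each `xᵢ` to the identity. -/
def color : ExampleGroup →* Multiplicative (ZMod 4) :=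
  SemidirectProduct.rightHom.comp toSemidirect

theorem color_freeHom (f : FreeGroup (ZMod 4)) : color (freeHom f) = 1 := by
  rw [color, MonoidHom.comp_apply, toSemidirect_freeHom, SemidirectProduct.rightHom_inl]

theorem color_tElem_pow (n : ℕ) : (color (tElem ^ n)).toAdd = n := by
  have : color tElem = Multiplicative.ofAdd 1 := by
    rw [color, MonoidHom.comp_apply, toSemidirect, tElem, PresentedGroup.toGroup.of,
      genToSemidirect, SemidirectProduct.rightHom_inr]
  rw [map_pow, this, toAdd_pow, toAdd_ofAdd, nsmul_one]

theorem exists_eq_tElem_pow_color_mul_freeHom (g : ExampleGroup) :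
    ∃ f : FreeGroup (ZMod 4), g = tElem ^ (color g).toAdd.val * freeHom f := by
  obtain ⟨n, f, rfl⟩ := exists_eq_tElem_pow_mul_freeHom g
  refine ⟨f, ?_⟩
  rw [map_mul, color_freeHom, mul_one, color_tElem_pow, ZMod.val_natCast,
    ← pow_eq_pow_mod n tElem_pow_four]

/-! ### Conjugates of `L₁` and their colors -/

theorem L₁_eq_map : L₁ = (freeFactor {i : ZMod 4 | i ≠ 0}).map freeHom := by
  have : {i : ZMod 4 | i ≠ 0} = {1, 2, 3} := by
    ext i
    simp only [Set.mem_ofPred_eq, Set.mem_insert_iff, Set.mem_singleton_iff]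
    revert i
    decide
  rw [this, freeFactor, MonoidHom.map_closure, L₁]
  simp only [Set.image_insert_eq, Set.image_singleton, freeHom_of]

theorem color_of_mem_L₁ {y : ExampleGroup} (hy : y ∈ L₁) : color y = 1 := by
  rw [L₁_eq_map] at hy
  obtain ⟨w, -, rfl⟩ := hy
  exact color_freeHom w

theorem color_eq_of_rightCoset_eq {a b : ExampleGroup} (h : rightCoset L₁ a = rightCoset L₁ b) :
    color a = color b := by
  have : a ∈ rightCoset L₁ b := h ▸ ⟨1, one_mem _, (one_mul a).symm⟩
  obtain ⟨c, hc, rfl⟩ := this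
  rw [map_mul, color_of_mem_L₁ hc, one_mul]

theorem color_eq_of_dblCoset_eq {a b : ExampleGroup} (h : dblCoset L₁ a = dblCoset L₁ b) :
    color a = color b := by
  have : a ∈ dblCoset L₁ b := h ▸ ⟨1, one_mem _, 1, one_mem _, by simp⟩
  obtain ⟨c, hc, d, hd, rfl⟩ := this
  rw [map_mul, map_mul, color_of_mem_L₁ hc, color_of_mem_L₁ hd, one_mul, mul_one]

theorem image_add_right_ne_zero (k : ZMod 4) :
    (· + k) '' {i : ZMod 4 | i ≠ 0} = {i | i ≠ k} := by
  ext i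
  simp only [Set.mem_image, Set.mem_ofPred_eq]
  constructor
  · rintro ⟨j, hj, rfl⟩
    simpa using hj
  · exact fun h => ⟨i - k, sub_ne_zero.2 h, sub_add_cancel i k⟩

theorem mem_conjBy_tElem_pow {n : ℕ} {y : ExampleGroup} :
    y ∈ conjBy L₁ (tElem ^ n) ↔ ∃ v ∈ freeFactor {i : ZMod 4 | i ≠ n}, freeHom v = y := by
  rw [mem_conjBy, L₁_eq_map, ← image_add_right_ne_zero n, ← map_freeFactor]
  constructor
  · rintro ⟨v, hv, hvy⟩
    refine ⟨_, ⟨v, hv, rfl⟩, ?_⟩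
    change freeHom (FreeGroup.map (· + (n : ZMod 4)) v) = y
    rw [← inv_tElem_pow_mul_freeHom_mul_tElem_pow, hvy]
    group
  · rintro ⟨_, ⟨v, hv, rfl⟩, rfl⟩
    refine ⟨v, hv, ?_⟩
    change _ = tElem ^ n * freeHom (FreeGroup.map (· + (n : ZMod 4)) v) * (tElem ^ n)⁻¹
    rw [← inv_tElem_pow_mul_freeHom_mul_tElem_pow]
    group

theorem exists_freeHom_eq_of_mem_conjBy {n : ℕ} {f : FreeGroup (ZMod 4)} {y : ExampleGroup}
    (hy : y ∈ conjBy L₁ (tElem ^ n * freeHom f)) :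
    ∃ w, freeHom w = y ∧ f * w * f⁻¹ ∈ freeFactor {i : ZMod 4 | i ≠ n} := by
  have : freeHom f * y * (freeHom f)⁻¹ ∈ conjBy L₁ (tElem ^ n) := by
    rw [mem_conjBy] at hy ⊢
    simpa only [mul_inv_rev, mul_assoc] using hy
  obtain ⟨v, hv, hvy⟩ := mem_conjBy_tElem_pow.1 this
  refine ⟨f⁻¹ * v * f, ?_, by simpa [mul_assoc] using hv⟩
  rw [map_mul, map_mul, map_inv, hvy]
  group

theorem tElem_pow_conj_mem_L₁ {n : ℕ} {v : FreeGroup (ZMod 4)}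
    (hv : v ∈ freeFactor {i : ZMod 4 | i ≠ n}) : tElem ^ n * freeHom v * (tElem ^ n)⁻¹ ∈ L₁ :=
  mem_conjBy.1 (mem_conjBy_tElem_pow.2 ⟨v, hv, rfl⟩)

theorem rightCoset_eq_of_color_eq {a b : ExampleGroup} (hc : color a = color b)
    (h : Infinite ↥(conjBy L₁ a ⊓ conjBy L₁ b)) : rightCoset L₁ a = rightCoset L₁ b := by
  obtain ⟨y, hy, hy1⟩ := exists_mem_ne_one_of_infinite h
  obtain ⟨f, hf⟩ := exists_eq_tElem_pow_color_mul_freeHom a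
  obtain ⟨g, hg⟩ := exists_eq_tElem_pow_color_mul_freeHom b
  rw [← hc] at hg
  generalize (color a).toAdd.val = n at hf hg
  subst hf hg
  obtain ⟨w, rfl, hw⟩ := exists_freeHom_eq_of_mem_conjBy hy.1
  obtain ⟨w', hww', hw'⟩ := exists_freeHom_eq_of_mem_conjBy hy.2
  obtain rfl := freeHom_injective hww'
  obtain ⟨p, hp, q, hq, hpq⟩ := exists_mul_eq_of_conj_mem_freeFactor (u := f * g⁻¹) hw'
    (by rw [ne_eq, conj_eq_one_iff]; rintro rfl; exact hy1 (map_one _))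
    (by simpa [mul_assoc] using hw)
  apply rightCoset_eq_of_mul_inv_mem
  convert tElem_pow_conj_mem_L₁ (mul_mem hp hq) using 1
  rw [← hpq, map_mul, map_inv]
  group

theorem dblCoset_eq_of_infinite {a : ExampleGroup} (h : Infinite ↥(L₁ ⊓ conjBy L₁ a)) :
    dblCoset L₁ a = dblCoset L₁ (tElem ^ (color a).toAdd.val) := by
  obtain ⟨y, hy, hy1⟩ := exists_mem_ne_one_of_infinite h
  obtain ⟨f, hf⟩ := exists_eq_tElem_pow_color_mul_freeHom a
  generalize (color a).toAdd.val = n at hf ⊢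
  subst hf
  obtain ⟨w, rfl, hw⟩ := exists_freeHom_eq_of_mem_conjBy hy.2
  have hL := hy.1
  rw [SetLike.mem_coe, L₁_eq_map] at hL
  obtain ⟨w', hw', hww'⟩ := hL
  obtain rfl := freeHom_injective hww'
  obtain ⟨p, hp, q, hq, rfl⟩ := exists_mul_eq_of_conj_mem_freeFactor hw'
    (by rintro rfl; exact hy1 (map_one _)) hw
  rw [← dblCoset_mul_mul (tElem_pow_conj_mem_L₁ hp)
    -- With `f = p * q`, the element is `(t ^ n * p * t⁻ⁿ) * t ^ n * q`, whose outer factors lie in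
    -- `L₁`.
    (L₁_eq_map ▸ ⟨q, hq, rfl⟩ : freeHom q ∈ L₁) (tElem ^ n), map_mul]
  congr 1
  group

/-! ### Witness families and upper bounds -/

theorem infinite_of_x_mem {H : Subgroup ExampleGroup} {j : ZMod 4} (h : x j ∈ H) :
    Infinite H := by
  refine Infinite.of_injective (fun n : ℕ => (⟨x j ^ n, pow_mem h n⟩ : H)) fun m n hmn => ?_
  have hpow : x j ^ m = x j ^ n := congrArg Subtype.val hmn
  rw [← freeHom_of, ← map_pow, ← map_pow] at hpow
  have := congrArg FreeGroup.norm (freeHom_injective hpow)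
  rwa [FreeGroup.norm_of_pow, FreeGroup.norm_of_pow] at this

theorem x_mem_conjBy_tElem_pow {n : ℕ} {j : ZMod 4} (h : j ≠ n) :
    x j ∈ conjBy L₁ (tElem ^ n) :=
  mem_conjBy_tElem_pow.2 ⟨_, of_mem_freeFactor h, freeHom_of j⟩

theorem infinite_L₁ : Infinite L₁ :=
  infinite_of_x_mem (j := 1) (Subgroup.subset_closure (by simp))

theorem color_tElem_pow_fin_injective {m : ℕ} (hm : m ≤ 4) :
    Function.Injective fun i : Fin m => color (tElem ^ (i : ℕ)) := by
  intro i j hij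
  have := congrArg Multiplicative.toAdd hij
  simp only [color_tElem_pow] at this
  rw [ZMod.natCast_eq_natCast_iff', Nat.mod_eq_of_lt (i.2.trans_le hm),
    Nat.mod_eq_of_lt (j.2.trans_le hm)] at this
  exact Fin.ext this

theorem le_four_of_injective {n : ℕ} {c : Fin n → Multiplicative (ZMod 4)}
    (hc : Function.Injective c) : n ≤ 4 := by
  simpa [ZMod.card] using Fintype.card_le_of_injective c hc

theorem color_injective_of_width {n : ℕ} {g : Fin n → ExampleGroup}
    (hg : EssentiallyDistinct L₁ g)
    (hinf : ∀ i j, i ≠ j → Infinite ↥(conjBy L₁ (g i) ⊓ conjBy L₁ (g j))) :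
    Function.Injective fun i => color (g i) := by
  intro i j hij
  by_contra hne
  exact hg i j hne (rightCoset_eq_of_color_eq hij (hinf i j hne))

theorem not_surjective_color_of_infinite_iInf {n : ℕ} {g : Fin n → ExampleGroup}
    (hinf : Infinite ↥(⨅ i, conjBy L₁ (g i))) : ¬ Function.Surjective fun i => color (g i) := by
  intro hs
  obtain ⟨y, hy, hy1⟩ := exists_mem_ne_one_of_infinite hinf
  rw [Subgroup.mem_iInf] at hy
  have key (k : ZMod 4) : ∃ w, freeHom w = y ∧
      ∃ f, f * w * f⁻¹ ∈ freeFactor {i : ZMod 4 | i ≠ k} := by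
    obtain ⟨i, hi⟩ := hs (Multiplicative.ofAdd k)
    obtain ⟨f, hf⟩ := exists_eq_tElem_pow_color_mul_freeHom (g i)
    have hyi := hy i
    rw [hf] at hyi
    obtain ⟨w, hw, hfw⟩ := exists_freeHom_eq_of_mem_conjBy hyi
    simp only at hi
    rw [hi, toAdd_ofAdd, ZMod.natCast_zmod_val] at hfw
    exact ⟨w, hw, f, hfw⟩
  obtain ⟨w, rfl, -⟩ := key 0
  have hw1 : w ≠ 1 := by rintro rfl; exact hy1 (map_one _)
  obtain ⟨f, hf⟩ := exists_conj_mem_freeFactor_iInter Finset.univ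
    (fun k : ZMod 4 => {i : ZMod 4 | i ≠ k}) hw1 fun k _ => by
      obtain ⟨w', hw', h⟩ := key k
      rwa [freeHom_injective hw'] at h
  rw [mem_freeFactor_iff] at hf
  refine hw1 ((conj_eq_one_iff (a := f)).1 (FreeGroup.toWord_eq_nil_iff.1
    (List.eq_nil_iff_forall_not_mem.2 fun z hz => ?_)))
  exact Set.mem_iInter₂.1 (hf z hz) z.1 (Finset.mem_univ _) rfl

theorem weakWidth_L₁ : weakWidth L₁ = 4 := by
  rw [weakWidth, if_neg (not_finite_iff_infinite.2 infinite_L₁)]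
  refine le_antisymm (iSup₂_le ?_) (le_iSup₂_of_le 4 ?_ le_rfl)
  · rintro n ⟨g, hg, i₀, hi₀, hinf⟩
    have hd (i : Fin n) : dblCoset L₁ (g i) = dblCoset L₁ (tElem ^ (color (g i)).toAdd.val) := by
      apply dblCoset_eq_of_infinite
      by_cases hi : i = i₀
      · rw [hi, hi₀, conjBy_one, inf_idem]
        exact infinite_L₁
      · exact hinf i hi
    have hc : Function.Injective fun i => color (g i) := by
      intro i j hij
      by_contra hne
      refine hg i j hne ?_
      rw [hd i, hd j]
      exact congrArg (fun c => dblCoset L₁ (tElem ^ (Multiplicative.toAdd c).val)) hij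
    exact_mod_cast le_four_of_injective hc
  · refine ⟨fun i => tElem ^ (i : ℕ), fun i j hij h =>
      hij (color_tElem_pow_fin_injective le_rfl (color_eq_of_dblCoset_eq h)), 0, pow_zero _,
      fun i _ => ?_⟩
    obtain ⟨j, hj0, hji⟩ : ∃ j : ZMod 4, j ≠ ((0 : ℕ) : ZMod 4) ∧ j ≠ ((i : ℕ) : ZMod 4) := by
      revert i; decide
    refine infinite_of_x_mem (j := j) (Subgroup.mem_inf.2 ⟨?_, x_mem_conjBy_tElem_pow hji⟩)
    simpa only [pow_zero, conjBy_one] using x_mem_conjBy_tElem_pow hj0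

theorem width_L₁ : width L₁ = 4 := by
  rw [width, if_neg (not_finite_iff_infinite.2 infinite_L₁)]
  refine le_antisymm (iSup₂_le ?_) (le_iSup₂_of_le 4 ?_ le_rfl)
  · rintro n ⟨g, hg, hinf⟩
    exact_mod_cast le_four_of_injective (color_injective_of_width hg hinf)
  · refine ⟨fun i => tElem ^ (i : ℕ), fun i j hij h =>
      hij (color_tElem_pow_fin_injective le_rfl (color_eq_of_rightCoset_eq h)), fun i k _ => ?_⟩
    obtain ⟨j, hji, hjk⟩ : ∃ j : ZMod 4, j ≠ ((i : ℕ) : ZMod 4) ∧ j ≠ ((k : ℕ) : ZMod 4) := by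
      clear * -
      revert i k; decide
    exact infinite_of_x_mem ⟨x_mem_conjBy_tElem_pow hji, x_mem_conjBy_tElem_pow hjk⟩

theorem height_L₁ : height L₁ = 3 := by
  rw [height, if_neg (not_finite_iff_infinite.2 infinite_L₁)]
  refine le_antisymm (iSup₂_le ?_) (le_iSup₂_of_le 3 ?_ le_rfl)
  · rintro n ⟨g, hg, hinf⟩
    have hc : Function.Injective fun i => color (g i) :=
      color_injective_of_width hg fun i j _ =>
        Infinite.of_injective _ (Subgroup.inclusion_injective
          (le_inf (iInf_le (fun i => conjBy L₁ (g i)) i) (iInf_le (fun i => conjBy L₁ (g i)) j)))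
    have hn : n ≠ 4 := by
      rintro rfl
      exact not_surjective_color_of_infinite_iInf hinf
        ((Fintype.bijective_iff_injective_and_card _).2 ⟨hc, by simp [ZMod.card]⟩).2
    have := le_four_of_injective hc
    exact_mod_cast (show n ≤ 3 by omega)
  · refine ⟨fun i => tElem ^ (i : ℕ), fun i j hij h =>
      hij (color_tElem_pow_fin_injective (by norm_num) (color_eq_of_rightCoset_eq h)), ?_⟩
    -- The conjugates by `1`, `t`, `t ^ 2` omit the letters 0, 1, 2, so `x 3` survives in all of
    -- them.
    refine infinite_of_x_mem (j := 3) (Subgroup.mem_iInf.2 fun i => x_mem_conjBy_tElem_pow ?_)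
    revert i; decide

end SubgroupWidth

theorem mainTheorem3 :
    SubgroupWidth.weakWidth SubgroupWidth.L₁ = 4 ∧
      SubgroupWidth.width SubgroupWidth.L₁ = 4 ∧
      SubgroupWidth.height SubgroupWidth.L₁ = 3 ∧
      SubgroupWidth.width SubgroupWidth.L₁ ≠ SubgroupWidth.height SubgroupWidth.L₁ := by
  refine ⟨SubgroupWidth.weakWidth_L₁, SubgroupWidth.width_L₁, SubgroupWidth.height_L₁, ?_⟩
  rw [SubgroupWidth.width_L₁, SubgroupWidth.height_L₁]
  decide
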